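/- Let $c,\lambda>0$ and let $\mathcal{T}(t)=\int_0^t V(0)(-1)^{N(s)}\,ds$, $t\ge 0$, be the symmetric telegraph process, where $V(0)$ is a random variable with $P\{V(0)=c\}=P\{V(0)=-c\}=\tfrac12$ and $N$ is a homogeneous Poisson process with rate $\lambda$ that is independent of $V(0)$. Then for every integer $k\ge 0$ and all real $t,\beta$ with $t>0$ and $0<\beta<ct$, $$P\Bigl\{\max_{0\le s\le t}\mathcal{T}(s)<\beta\ \Big|\ V(0)=-c,\ N(t)=2k+1\Bigr\}=\frac{\beta}{ct}\sum_{j=0}^{k-1}\Bigl(\frac{c^2t^2-\beta^2}{c^2t^2}\Bigr)^{j}\frac{1}{2^{2j}}\binom{2j}{j}+\frac{(2k)!}{k!\,(k+1)!}\,\frac{(c^2t^2-\beta^2)^k}{2\,(2ct)^{2k}}\Bigl(\frac{\beta}{ct}+2k+1\Bigr),$$ where the sum is empty (equal to $0$) for $k=0$. -/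

import Mathlib

open MeasureTheory ProbabilityTheory Set
open scoped NNReal

/-- A homogeneous Poisson process `N` with rate `lam` under `μ`: it starts at `0`, has independent
increments, the increment over `(s, t]` is Poisson distributed with mean `lam * (t - s)`, and
almost every path is nondecreasing and right-continuous. -/
structure IsPoissonProcess {Ω : Type*} [MeasurableSpace Ω] (N : ℝ≥0 → Ω → ℕ) (lam : ℝ≥0)
    (μ : Measure Ω) : Prop where
  measurable : ∀ t, Measurable (N t)
  zero : ∀ᵐ ω ∂μ, N 0 ω = 0
  indepIncrements : HasIndepIncrements N μ
  law_increment : ∀ s t, s ≤ t →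
    HasLaw (fun ω => N t ω - N s ω) (poissonMeasure (lam * (t - s))) μ
  monotone_path : ∀ᵐ ω ∂μ, Monotone fun t => N t ω
  rightContinuous_path : ∀ᵐ ω ∂μ, ∀ t, ContinuousWithinAt (fun s => N s ω) (Ici t) t

/-- The data `(V, N)` driving a symmetric telegraph process with speed `c` and rate `lam`: an
initial velocity `V` equal to `c` or `-c` with probability `1/2` each, and an independent
homogeneous Poisson process `N` counting the changes of direction. -/
structure IsTelegraphData {Ω : Type*} [MeasurableSpace Ω] (V : Ω → ℝ) (N : ℝ≥0 → Ω → ℕ)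
    (c : ℝ) (lam : ℝ≥0) (μ : Measure Ω) : Prop where
  measurable_velocity : Measurable V
  prob_pos : μ {ω | V ω = c} = 1 / 2
  prob_neg : μ {ω | V ω = -c} = 1 / 2
  poisson : IsPoissonProcess N lam μ
  indep : IndepFun V (fun ω t => N t ω) μ

/-- The telegraph process `𝒯(t) = ∫₀ᵗ V (-1)^{N(s)} ds`. -/
noncomputable def telegraph {Ω : Type*} (V : Ω → ℝ) (N : ℝ≥0 → Ω → ℕ) (t : ℝ≥0) (ω : Ω) : ℝ :=
  ∫ s in (0 : ℝ)..t, V ω * (-1) ^ N s.toNNReal ω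

/-- The maximum of the telegraph process over the time interval `[0, t]`. -/
noncomputable def telegraphMax {Ω : Type*} (V : Ω → ℝ) (N : ℝ≥0 → Ω → ℕ) (t : ℝ≥0) (ω : Ω) : ℝ :=
  sSup ((fun s => telegraph V N s ω) '' Icc 0 t)

/-- On every nondecreasing path of `N`, the supremum in `telegraphMax` is an attained maximum. -/
theorem telegraphMax_isGreatest {Ω : Type*} (V : Ω → ℝ) (N : ℝ≥0 → Ω → ℕ) (t : ℝ≥0) (ω : Ω)
    (h : Monotone fun s => N s ω) :
    IsGreatest ((fun s => telegraph V N s ω) '' Icc 0 t) (telegraphMax V N t ω) := by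
  have hm : Measurable fun s : ℝ => V ω * (-1 : ℝ) ^ N s.toNNReal ω := by
    have h1 : Measurable fun s : ℝ => N s.toNNReal ω :=
      (h.comp fun a b hab => Real.toNNReal_mono hab).measurable
    exact measurable_const.mul ((measurable_from_top (f := fun n : ℕ => (-1 : ℝ) ^ n)).comp h1)
  have hi : ∀ a b : ℝ, IntervalIntegrable (fun s : ℝ => V ω * (-1 : ℝ) ^ N s.toNNReal ω)
      volume a b := by
    intro a b
    refine (intervalIntegrable_const (c := |V ω|)).mono_fun hm.aestronglyMeasurable ?_
    exact Filter.Eventually.of_forall fun s => by simp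
  have hc : Continuous fun s : ℝ≥0 => telegraph V N s ω :=
    (intervalIntegral.continuous_primitive hi 0).comp NNReal.continuous_coe
  exact (isCompact_Icc.image hc).isGreatest_sSup ((nonempty_Icc.2 zero_le).image _)

/-! The proof is a discretisation. Divide `[0, t]` into `m` equal cells. Given `N t = n`, the
probability that some cell contains two or more jumps tends to `0`, and otherwise the set `J` of
cells that contain a jump is uniform among the `n`-subsets (`measureReal_cellEvent`). Such a `J`
encodes a lattice walk that starts downwards and turns at each marked cell. At grid points the
telegraph path differs from this walk, scaled by `c * t / m`, by at most `2 * n` scaled steps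
(`abs_telegraph_sub_upSteps_le`). With `x = β / (c * t)`, the conditional probability is therefore
squeezed between normalised numbers of walks that stay below levels `m * x + O(1)`
(`boundedPaths_bounds`).

For `n = 2k + 1` those numbers are exact: a reflection formula (`card_markedPaths_reflection`)
counts walks with a given endpoint as a difference of two products of binomials. Summed over the
endpoint and divided by the right power of `m`, the products become incomplete beta integrals
(`tendsto_sum_choose_mul_choose`), which gives `staysBelowLimit k x`. Its closed form follows since
both sides have the same derivative in `x` and the value `1` at `x = 1` (`staysBelowLimit_eq`). -/

/-! ### Lattice walks with a prescribed number of turns. -/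

/-- The number of marked cells among the first `i` cells. -/
def markCount (J : Finset ℕ) (i : ℕ) : ℕ := (J.filter (· < i)).card

/-- The number of up-steps among the first `i` steps of the walk which starts in the downward
direction and turns at every marked cell. -/
def upSteps (J : Finset ℕ) (i : ℕ) : ℕ :=
  -- The `j + 1` makes a mark on cell `j` act on step `j` itself, so the walk goes up at once when
  -- cell `0` is marked.
  ((Finset.range i).filter fun j => Odd (markCount J (j + 1))).card

/-- The sets of `n` marked cells among the first `m` cells whose walk makes `u` up-steps and
stays at or below level `b`. -/
def markedPaths (b n m u : ℕ) : Finset (Finset ℕ) :=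
  ((Finset.range m).powersetCard n).filter fun J =>
    upSteps J m = u ∧ ∀ i ≤ m, 2 * upSteps J i ≤ i + b

lemma upSteps_succ (J : Finset ℕ) (i : ℕ) :
    upSteps J (i + 1) = upSteps J i + if Odd (markCount J (i + 1)) then 1 else 0 := by
  unfold upSteps
  rw [Finset.range_add_one, Finset.filter_insert]
  split_ifs <;> simp

lemma upSteps_zero (J : Finset ℕ) : upSteps J 0 = 0 := by simp [upSteps]

lemma upSteps_le (J : Finset ℕ) (i : ℕ) : upSteps J i ≤ i :=
  (Finset.card_filter_le _ _).trans (by simp)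

lemma markCount_insert_of_le {J : Finset ℕ} {m i : ℕ} (h : i ≤ m) :
    markCount (insert m J) i = markCount J i := by
  unfold markCount
  rw [Finset.filter_insert, if_neg (by omega)]

lemma upSteps_insert_of_le {J : Finset ℕ} {m i : ℕ} (h : i ≤ m) :
    upSteps (insert m J) i = upSteps J i := by
  unfold upSteps
  congr 1
  refine Finset.filter_congr fun j hj => ?_
  rw [markCount_insert_of_le (by have := Finset.mem_range.1 hj; omega)]

lemma markCount_of_subset {J : Finset ℕ} {m i : ℕ} (h : J ⊆ Finset.range m) (hi : m ≤ i) :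
    markCount J i = J.card := by
  unfold markCount
  rw [Finset.filter_true_of_mem]
  intro j hj
  have := Finset.mem_range.1 (h hj)
  omega

/-- Used to delete the last cell: the last step is up or down according to the parity of the total
number of marks, and the only new constraint concerns the endpoint. The two cases, last cell
unmarked or marked, give Pascal-type recurrences for the counts. -/
lemma mem_markedPaths_succ_of_subset {b n m u : ℕ} {J : Finset ℕ}
    (hJ : J ∈ (Finset.range m).powersetCard n) :
    (upSteps J (m + 1) = u ∧ ∀ i ≤ m + 1, 2 * upSteps J i ≤ i + b) ↔
      (upSteps J m + (if Odd n then 1 else 0) = u ∧ ∀ i ≤ m, 2 * upSteps J i ≤ i + b)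
        ∧ 2 * u ≤ m + 1 + b := by
  obtain ⟨h1, h2⟩ := Finset.mem_powersetCard.1 hJ
  have h3 := upSteps_succ J m
  rw [markCount_of_subset h1 (by omega), h2] at h3
  rw [h3]
  constructor
  · rintro ⟨h4, h5⟩
    refine ⟨⟨h4, fun i hi => h5 i (by omega)⟩, ?_⟩
    have := h5 (m + 1) le_rfl
    omega
  · rintro ⟨⟨h4, h5⟩, h6⟩
    refine ⟨h4, fun i hi => ?_⟩
    rcases Nat.lt_or_ge m i with h | h
    · obtain rfl : i = m + 1 := by omega
      omega
    · exact h5 i h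

lemma mem_markedPaths_succ_of_insert {b n m u : ℕ} {J : Finset ℕ}
    (hJ : J ∈ (Finset.range m).powersetCard n) :
    (upSteps (insert m J) (m + 1) = u ∧ ∀ i ≤ m + 1, 2 * upSteps (insert m J) i ≤ i + b) ↔
      (upSteps J m + (if Odd (n + 1) then 1 else 0) = u ∧ ∀ i ≤ m, 2 * upSteps J i ≤ i + b)
        ∧ 2 * u ≤ m + 1 + b := by
  obtain ⟨h1, h2⟩ := Finset.mem_powersetCard.1 hJ
  have hm : m ∉ J := fun h => by simpa using h1 h
  have h0 : insert m J ⊆ Finset.range (m + 1) := by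
    rw [Finset.range_add_one]
    exact Finset.insert_subset_insert _ h1
  have h3 := upSteps_succ (insert m J) m
  rw [markCount_of_subset h0 le_rfl, Finset.card_insert_of_notMem hm, h2,
    upSteps_insert_of_le le_rfl] at h3
  rw [h3]
  constructor
  · rintro ⟨h4, h5⟩
    refine ⟨⟨h4, fun i hi => ?_⟩, ?_⟩
    · rw [← upSteps_insert_of_le (J := J) hi]
      exact h5 i (by omega)
    · have := h5 (m + 1) le_rfl
      omega
  · rintro ⟨⟨h4, h5⟩, h6⟩
    refine ⟨h4, fun i hi => ?_⟩
    rcases Nat.lt_or_ge m i with h | h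
    · obtain rfl : i = m + 1 := by omega
      omega
    · rw [upSteps_insert_of_le h]
      exact h5 i h

lemma card_filter_insert_powersetCard (n m : ℕ) (p : Finset ℕ → Prop) [DecidablePred p] :
    (((Finset.range (m + 1)).powersetCard (n + 1)).filter p).card =
      (((Finset.range m).powersetCard (n + 1)).filter p).card
        + (((Finset.range m).powersetCard n).filter fun J => p (insert m J)).card := by
  have hm : m ∉ Finset.range m := by simp
  rw [Finset.range_add_one, Finset.powersetCard_succ_insert hm, Finset.filter_union,
    Finset.card_union_of_disjoint, Finset.filter_image, Finset.card_image_of_injOn]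
  · intro J hJ K hK h
    have h1 : m ∉ J := fun h => hm ((Finset.mem_powersetCard.1
      (Finset.mem_filter.1 hJ).1).1 h)
    have h2 : m ∉ K := fun h => hm ((Finset.mem_powersetCard.1
      (Finset.mem_filter.1 hK).1).1 h)
    rw [← Finset.erase_insert h1, ← Finset.erase_insert h2]
    exact congrArg (fun s => s.erase m) h
  · rw [Finset.disjoint_left]
    intro J h1 h2
    obtain ⟨K, -, rfl⟩ := Finset.mem_image.1 (Finset.mem_filter.1 h2).1
    exact hm ((Finset.mem_powersetCard.1 (Finset.mem_filter.1 h1).1).1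
      (Finset.mem_insert_self _ _))

lemma card_markedPaths_succ_odd {b n m u : ℕ} (hn : Odd (n + 1)) (hu : 2 * (u + 1) ≤ m + 1 + b) :
    (markedPaths b (n + 1) (m + 1) (u + 1)).card =
      (markedPaths b (n + 1) m u).card + (markedPaths b n m u).card := by
  unfold markedPaths
  rw [card_filter_insert_powersetCard]
  congr 2
  · refine Finset.filter_congr fun J hJ => ?_
    rw [mem_markedPaths_succ_of_subset hJ, if_pos hn]
    simp [hu]
  · refine Finset.filter_congr fun J hJ => ?_
    rw [mem_markedPaths_succ_of_insert hJ, if_pos hn]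
    simp [hu]

lemma card_markedPaths_succ_even {b n m u : ℕ} (hn : ¬ Odd (n + 1)) (hu : 2 * u ≤ m + 1 + b) :
    (markedPaths b (n + 1) (m + 1) u).card =
      (markedPaths b (n + 1) m u).card + (markedPaths b n m u).card := by
  unfold markedPaths
  rw [card_filter_insert_powersetCard]
  congr 2
  · refine Finset.filter_congr fun J hJ => ?_
    rw [mem_markedPaths_succ_of_subset hJ, if_neg hn]
    simp [hu]
  · refine Finset.filter_congr fun J hJ => ?_
    rw [mem_markedPaths_succ_of_insert hJ, if_neg hn]
    simp [hu]

lemma markedPaths_eq_empty_of_lt {b n m u : ℕ} (hu : m + b < 2 * u) :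
    markedPaths b n m u = ∅ := by
  refine Finset.filter_eq_empty_iff.2 ?_
  rintro J - ⟨h1, h2⟩
  have := h2 m le_rfl
  omega

lemma markedPaths_eq_empty_of_length_lt {b n m u : ℕ} (hu : m < u) :
    markedPaths b n m u = ∅ := by
  refine Finset.filter_eq_empty_iff.2 ?_
  rintro J - ⟨h1, h2⟩
  have := upSteps_le J m
  omega

lemma card_markedPaths_zero (b m : ℕ) (u : ℕ) :
    (markedPaths b 0 m u).card = if u = 0 then 1 else 0 := by
  have h (i : ℕ) : upSteps ∅ i = 0 := by simp [upSteps, markCount]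
  unfold markedPaths
  rw [Finset.powersetCard_zero, Finset.filter_singleton, h]
  by_cases hu : u = 0 <;> simp [hu, h, eq_comm]

lemma card_markedPaths_length_zero (b n u : ℕ) : (markedPaths b (n + 1) 0 u).card = 0 := by
  simp [markedPaths]

lemma card_markedPaths_odd_zero {b k m : ℕ} : (markedPaths b (2 * k + 1) m 0).card = 0 := by
  rw [Finset.card_eq_zero]
  refine Finset.filter_eq_empty_iff.2 ?_
  rintro J hJ ⟨h1, -⟩
  obtain ⟨h2, h3⟩ := Finset.mem_powersetCard.1 hJ
  rcases m with _ | m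
  · simp only [Finset.range_zero, Finset.subset_empty] at h2
    simp [h2] at h3
  · rw [upSteps_succ, markCount_of_subset h2 le_rfl, h3, if_pos ⟨k, rfl⟩] at h1
    omega

/-! ### The reflection formula, by recurrence. -/

/-- Reflection principle for the walks with a given number of turns: the last step goes up in the
first statement and down in the second. -/
theorem card_markedPaths_reflection (b : ℕ) (m : ℕ) :
    (∀ k u d, d + (u + 1) = m → u + 1 ≤ d + (b + 1) →
      (markedPaths (b + 1) (2 * k + 1) m (u + 1)).card
        + (if k = 0 then 0 else (u - b).choose (k + 1) * (d + b).choose (k - 1))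
        = d.choose k * u.choose k) ∧
    (∀ k u d, d + (u + 1) = m → u + 1 ≤ d + (b + 1) →
      (markedPaths (b + 1) (2 * k + 2) m (u + 1)).card
        + (u - b).choose (k + 1) * (d + b).choose k = d.choose (k + 1) * u.choose k) ∧
    (∀ k, (markedPaths (b + 1) (2 * k + 2) m 0).card = 0) := by
  -- The right-hand products count unrestricted walks: the up-steps split into `k + 1` nonempty
  -- runs, the down-steps into runs of which only the first may be empty. The added products count
  -- the walks that exceed the level. No bijection is built: both products satisfy the same
  -- recurrences as the counts, so only the boundary cases need care.
  induction m with
  | zero =>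
    refine ⟨fun k u d h => by omega, fun k u d h => by omega, fun k => ?_⟩
    exact card_markedPaths_length_zero _ _ _
  | succ m ih =>
    obtain ⟨ih1, ih2, ih3⟩ := ih
    refine ⟨fun k u d h hb => ?_, fun k u d h hb => ?_, fun k => ?_⟩
    · rw [card_markedPaths_succ_odd ⟨k, rfl⟩ (by omega)]
      rcases u with _ | u
      · rw [card_markedPaths_odd_zero]
        rcases k with _ | k
        · simp [card_markedPaths_zero]
        · simp [ih3, Nat.mul_add]
      · have h1 := ih1 k u d (by omega) (by omega)
        rcases k with _ | k
        · simpa [card_markedPaths_zero] using h1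
        · have h2 := ih2 k u d (by omega) (by omega)
          have h3 : (u + 1 - b).choose (k + 2) = (u - b).choose (k + 1) + (u - b).choose (k + 2) := by
            rcases Nat.lt_or_ge u b with h | h
            · rw [Nat.sub_eq_zero_of_le h.le, Nat.sub_eq_zero_of_le h]; simp
            · rw [Nat.sub_add_comm h, Nat.choose_succ_succ]
          have h4 := Nat.choose_succ_succ u k
          simp only [Nat.add_sub_cancel, Nat.succ_ne_zero, if_false, Nat.mul_add, Nat.mul_one,
            Nat.succ_eq_add_one] at h1 h2 h4 ⊢
          rw [h3, h4]
          linear_combination h1 + h2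
    · rw [card_markedPaths_succ_even (by simp [parity_simps]) (by omega)]
      rcases d with _ | d
      · rw [markedPaths_eq_empty_of_length_lt (by omega),
          markedPaths_eq_empty_of_length_lt (by omega), Nat.sub_eq_zero_of_le (by omega)]
        simp
      · rcases Nat.lt_or_ge (d + (b + 1)) (u + 1) with hlt | hge
        -- A final down-step would have to come from just above the level, so no walk is admissible;
        -- here `u = d + 1 + b` and the two products coincide.
        · rw [markedPaths_eq_empty_of_lt (by omega), markedPaths_eq_empty_of_lt (by omega)]
          obtain rfl : u = d + 1 + b := by omega
          simp
        · have h1 := ih1 k u d (by omega) hge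
          have h2 := ih2 k u d (by omega) hge
          rw [Nat.choose_succ_succ d k]
          rcases k with _ | k
          · simp only [Nat.choose_zero_right, if_true] at h1 h2 ⊢
            linear_combination h1 + h2
          · have h3 : (d + 1 + b).choose (k + 1) = (d + b).choose k + (d + b).choose (k + 1) := by
              rw [add_right_comm, Nat.choose_succ_succ]
            simp only [Nat.add_sub_cancel, Nat.succ_ne_zero, if_false,
              Nat.succ_eq_add_one] at h1 h2 ⊢
            rw [h3]
            linear_combination h1 + h2
    · rw [card_markedPaths_succ_even (by simp [parity_simps]) (by omega), ih3,
        card_markedPaths_odd_zero]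

/-! ### Binomial sums and beta integrals. -/

open Filter Topology in
lemma tendsto_choose_div_pow {a : ℕ → ℕ} {α : ℝ}
    (ha : Tendsto (fun m => (a m : ℝ) / m) atTop (𝓝 α)) (p : ℕ) :
    Tendsto (fun m => ((a m).choose p : ℝ) / m ^ p) atTop (𝓝 (α ^ p / p.factorial)) := by
  induction p with
  | zero => simp
  | succ p ih =>
    have h1 : Tendsto (fun m : ℕ => (a m : ℝ) / m - p / m) atTop (𝓝 (α - 0)) :=
      ha.sub (tendsto_const_div_atTop_nhds_zero_nat _)
    have h2 := (ih.mul h1).div_const ((p : ℝ) + 1)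
    rw [sub_zero] at h2
    convert h2 using 2 with m
    · have h3 : ((a m).choose (p + 1) : ℝ) * (p + 1) = (a m).choose p * (a m - p) := by
        rcases Nat.lt_or_ge (a m) p with h | h
        · simp [Nat.choose_eq_zero_of_lt h, Nat.choose_eq_zero_of_lt (h.trans (Nat.lt_succ_self p))]
        · rw [← Nat.cast_sub h]
          exact_mod_cast Nat.choose_succ_right_eq (a m) p
      have h4 : ((a m).choose (p + 1) : ℝ) = (a m).choose p * (a m - p) / (p + 1) := by
        rw [← h3]; field_simp
      rw [h4]
      rcases eq_or_ne (m : ℝ) 0 with h | h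
      · simp [h]
      · field_simp
        ring
    · rw [Nat.factorial_succ]; push_cast; field_simp; ring

/-- Writes a sum as the integral of a step function, so that dominated convergence can replace a
Riemann-sum argument. -/
lemma integral_floor (f : ℕ → ℝ) (a : ℕ) :
    IntervalIntegrable (fun s : ℝ => f ⌊s⌋₊) volume 0 a ∧
      ∫ s in (0 : ℝ)..a, f ⌊s⌋₊ = ∑ i ∈ Finset.range a, f i := by
  induction a with
  | zero => simp
  | succ a ih =>
    have hle : (a : ℝ) ≤ (a + 1 : ℕ) := by push_cast; linarith
    have hc : ∀ᵐ s : ℝ, s ∈ Set.uIoc (a : ℝ) (a + 1 : ℕ) → f a = f ⌊s⌋₊ := by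
      have h : ∀ᵐ s : ℝ, s ≠ (a + 1 : ℕ) := by simp [ae_iff, measure_singleton]
      filter_upwards [h] with s hs h1
      rw [Set.uIoc_of_le hle] at h1
      rw [(Nat.floor_eq_iff (by linarith [h1.1, (Nat.cast_nonneg a : (0 : ℝ) ≤ a)])).2
        ⟨h1.1.le, by have := lt_of_le_of_ne h1.2 hs; push_cast at this; exact this⟩]
    have hi : IntervalIntegrable (fun s : ℝ => f ⌊s⌋₊) volume a (a + 1 : ℕ) :=
      (intervalIntegrable_const (c := f a)).congr_ae
        ((ae_restrict_iff' measurableSet_uIoc).2 hc)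
    refine ⟨ih.1.trans hi, ?_⟩
    rw [← intervalIntegral.integral_add_adjacent_intervals ih.1 hi, ih.2, Finset.sum_range_succ,
      ← intervalIntegral.integral_congr_ae hc]
    simp

lemma integral_floor_mul (f : ℕ → ℝ) (a : ℕ) {m : ℕ} (hm : 0 < m) :
    ∫ s in (0 : ℝ)..a / m, f ⌊(m : ℝ) * s⌋₊ = (∑ i ∈ Finset.range a, f i) / m := by
  have hm' : (m : ℝ) ≠ 0 := by positivity
  rw [intervalIntegral.integral_comp_mul_left (fun s => f ⌊s⌋₊) hm', mul_zero,
    mul_div_cancel₀ _ hm', (integral_floor f a).2, smul_eq_mul, inv_mul_eq_div]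

open Filter Topology in
lemma tendsto_sum_choose_mul_choose {a : ℕ → ℕ} {α : ℝ} (hα : α ≤ 1)
    (ham : ∀ᶠ m in atTop, a m ≤ m)
    (ha : Tendsto (fun m => (a m : ℝ) / m) atTop (𝓝 α)) (p q : ℕ) :
    Tendsto (fun m => (∑ i ∈ Finset.range (a m), ((i.choose p * (m - 1 - i).choose q : ℕ) : ℝ))
        / m ^ (p + q + 1)) atTop
      (𝓝 ((∫ s in (0 : ℝ)..α, s ^ p * (1 - s) ^ q) / (p.factorial * q.factorial))) := by
  have hα0 : 0 ≤ α := ge_of_tendsto' ha fun m => by positivity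
  set F : ℕ → ℝ → ℝ := fun m s => (Set.Ioc (0 : ℝ) (a m / m)).indicator
    (fun s => ((⌊(m : ℝ) * s⌋₊.choose p * (m - 1 - ⌊(m : ℝ) * s⌋₊).choose q : ℕ) : ℝ)
      / m ^ (p + q)) s with hF
  have key : Tendsto (fun m => ∫ s in Set.Ioc (0 : ℝ) 1, F m s) atTop
      (𝓝 (∫ s in Set.Ioc (0 : ℝ) 1, (Set.Ioc 0 α).indicator
        (fun s => s ^ p / p.factorial * ((1 - s) ^ q / q.factorial)) s)) := by
    refine tendsto_integral_filter_of_dominated_convergence (fun _ => 1) ?_ ?_ ?_ ?_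
    · refine Eventually.of_forall fun m => Measurable.aestronglyMeasurable ?_
      refine Measurable.indicator ?_ measurableSet_Ioc
      have h : Measurable fun s : ℝ => ⌊(m : ℝ) * s⌋₊ :=
        Nat.measurable_floor.comp (measurable_const_mul _)
      exact (measurable_from_top (f := fun i : ℕ =>
        ((i.choose p * (m - 1 - i).choose q : ℕ) : ℝ) / m ^ (p + q))).comp h
    · filter_upwards [eventually_gt_atTop 0] with m hm
      refine (ae_restrict_iff' measurableSet_Ioc).2 (Eventually.of_forall fun s hs => ?_)
      refine (norm_indicator_le_norm_self _ _).trans ?_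
      have hm' : (0 : ℝ) < m := by positivity
      rw [Real.norm_of_nonneg (by positivity), div_le_one (by positivity)]
      have h1 : ⌊(m : ℝ) * s⌋₊ ≤ m := Nat.floor_le_of_le (by nlinarith [hs.2])
      have h2 : ⌊(m : ℝ) * s⌋₊.choose p ≤ m ^ p :=
        (Nat.choose_le_pow _ _).trans (Nat.pow_le_pow_left h1 _)
      have h3 : (m - 1 - ⌊(m : ℝ) * s⌋₊).choose q ≤ m ^ q :=
        (Nat.choose_le_pow _ _).trans (Nat.pow_le_pow_left (by omega) _)
      rw [pow_add]
      exact_mod_cast Nat.mul_le_mul h2 h3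
    · exact integrable_const _
    -- Two null points are dropped: the indicators may fail to converge at `α`, and `s < 1` keeps
    -- `⌊m * s⌋₊ < m`, so that the subtraction `m - 1 - ⌊m * s⌋₊` is not truncated.
    · have hne : ∀ᵐ s : ℝ, s ≠ α := by simp [ae_iff, measure_singleton]
      have hne1 : ∀ᵐ s : ℝ, s ≠ 1 := by simp [ae_iff, measure_singleton]
      refine (ae_restrict_iff' measurableSet_Ioc).2 ?_
      filter_upwards [hne, hne1] with s hs hs1 hs01
      rcases lt_or_gt_of_ne hs with h | h
      · have h1 : ∀ᶠ m in atTop, s < (a m : ℝ) / m := ha.eventually_const_lt h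
        rw [Set.indicator_of_mem (show s ∈ Set.Ioc 0 α from ⟨hs01.1, h.le⟩)]
        have hfl : Tendsto (fun m : ℕ => (⌊(m : ℝ) * s⌋₊ : ℝ) / m) atTop (𝓝 s) := by
          have := (tendsto_nat_floor_mul_div_atTop hs01.1.le).comp
            (tendsto_natCast_atTop_atTop (R := ℝ))
          simpa [Function.comp_def, mul_comm] using this
        have hfl2 : Tendsto (fun m : ℕ => ((m - 1 - ⌊(m : ℝ) * s⌋₊ : ℕ) : ℝ) / m) atTop
            (𝓝 (1 - s)) := by
          have h2 : Tendsto (fun m : ℕ => 1 - 1 / (m : ℝ) - (⌊(m : ℝ) * s⌋₊ : ℝ) / m) atTop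
            (𝓝 (1 - 0 - s)) :=
            (tendsto_const_nhds.sub (tendsto_const_div_atTop_nhds_zero_nat 1)).sub hfl
          rw [sub_zero] at h2
          refine h2.congr' ?_
          filter_upwards [eventually_gt_atTop 0] with m hm
          have hm' : (0 : ℝ) < m := by positivity
          have hlt : ⌊(m : ℝ) * s⌋₊ < m := by
            rw [Nat.floor_lt (by nlinarith [hs01.1])]
            nlinarith [lt_of_le_of_ne hs01.2 hs1]
          rw [Nat.sub_sub, Nat.cast_sub (by omega)]
          push_cast
          field_simp
          ring
        refine ((tendsto_choose_div_pow hfl p).mul (tendsto_choose_div_pow hfl2 q)).congr' ?_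
        filter_upwards [h1] with m hm
        rw [hF]
        simp only
        rw [Set.indicator_of_mem (show s ∈ Set.Ioc 0 ((a m : ℝ) / m) from ⟨hs01.1, hm.le⟩)]
        push_cast
        rw [pow_add, div_mul_div_comm]
      · have h1 : ∀ᶠ m in atTop, (a m : ℝ) / m < s := ha.eventually_lt_const h
        rw [Set.indicator_of_notMem fun hh => absurd hh.2 (not_le.2 h)]
        refine tendsto_const_nhds.congr' ?_
        filter_upwards [h1] with m hm
        rw [hF]
        simp only
        rw [Set.indicator_of_notMem fun hh => absurd hh.2 (not_le.2 hm)]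
  have hlim : (∫ s in Set.Ioc (0 : ℝ) 1, (Set.Ioc 0 α).indicator
        (fun s => s ^ p / p.factorial * ((1 - s) ^ q / q.factorial)) s)
      = (∫ s in (0 : ℝ)..α, s ^ p * (1 - s) ^ q) / (p.factorial * q.factorial) := by
    rw [setIntegral_indicator measurableSet_Ioc, Set.inter_eq_right.2
      (Set.Ioc_subset_Ioc_right hα), ← intervalIntegral.integral_of_le hα0,
      ← intervalIntegral.integral_div]
    simp only [div_mul_div_comm]
  rw [hlim] at key
  refine key.congr' ?_
  filter_upwards [eventually_gt_atTop 0, ham] with m hm hm2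
  have hm' : (0 : ℝ) < m := by positivity
  have h1 : (a m : ℝ) / m ≤ 1 := by
    rw [div_le_one hm']; exact_mod_cast hm2
  rw [hF]
  simp only
  rw [setIntegral_indicator measurableSet_Ioc, Set.inter_eq_right.2
      (Set.Ioc_subset_Ioc_right h1), ← intervalIntegral.integral_of_le (by positivity),
      integral_floor_mul (fun i => ((i.choose p * (m - 1 - i).choose q : ℕ) : ℝ)
      / m ^ (p + q)) _ hm, ← Finset.sum_div, div_div, ← pow_succ]

/-- Integration by parts: `s ^ (p + 1) * (1 - s) ^ (q + 1)` vanishes at both ends, which trades a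
power of `1 - s` for a power of `s`. -/
lemma integral_pow_mul_one_sub_pow (p q : ℕ) :
    ∫ s in (0 : ℝ)..1, s ^ p * (1 - s) ^ q
      = (p.factorial * q.factorial : ℝ) / (p + q + 1).factorial := by
  induction q generalizing p with
  | zero =>
    rw [Nat.factorial_succ]
    have := Nat.factorial_ne_zero p
    simp
    field_simp
  | succ q ih =>
    have h1 (s : ℝ) : HasDerivAt (fun s : ℝ => s ^ (p + 1) * (1 - s) ^ (q + 1))
        ((p + 1) * (s ^ p * (1 - s) ^ (q + 1)) - (q + 1) * (s ^ (p + 1) * (1 - s) ^ q)) s := by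
      have := (hasDerivAt_pow (p + 1) s).mul (((hasDerivAt_id s).const_sub 1).pow (q + 1))
      convert! this using 1
      simp
      ring
    have h2 := intervalIntegral.integral_eq_sub_of_hasDerivAt (a := 0) (b := 1)
      (fun s _ => h1 s) (by apply Continuous.intervalIntegrable; fun_prop)
    rw [intervalIntegral.integral_sub (by apply Continuous.intervalIntegrable; fun_prop)
      (by apply Continuous.intervalIntegrable; fun_prop), intervalIntegral.integral_const_mul,
      intervalIntegral.integral_const_mul, ih (p + 1)] at h2
    simp only [sub_self, zero_pow (Nat.succ_ne_zero _), mul_zero, zero_mul] at h2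
    have h3 : p + 1 + q + 1 = p + (q + 1) + 1 := by ring
    rw [h3] at h2
    have h4 : ((p + (q + 1) + 1).factorial : ℝ) ≠ 0 := by positivity
    have h5 : ((p : ℝ) + 1) ≠ 0 := by positivity
    rw [← mul_right_inj' h5, sub_eq_zero.1 h2, Nat.factorial_succ p, Nat.factorial_succ q]
    push_cast
    ring

/-! ### The limit and its closed form. -/

/-- The limiting probability that a walk with `2k + 1` turns stays below level `x`. -/
noncomputable def staysBelowLimit (k : ℕ) (x : ℝ) : ℝ :=
  (2 * k + 1).factorial * ((∫ s in (0 : ℝ)..(1 + x) / 2, s ^ k * (1 - s) ^ k)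
      / (k.factorial * k.factorial)
    -- With a single turn the walk goes down and then up, so the endpoint alone decides and there is
    -- no reflected term.
    - if k = 0 then 0 else (∫ s in (0 : ℝ)..(1 - x) / 2, s ^ (k + 1) * (1 - s) ^ (k - 1))
      / ((k + 1).factorial * (k - 1).factorial))

/-- The real number `(2k)! / (k! (k+1)!)`, that is, the `k`-th Catalan number. -/
noncomputable def catalanReal (k : ℕ) : ℝ :=
  ((2 * k).factorial : ℝ) / ((k.factorial : ℝ) * ((k + 1).factorial : ℝ))

lemma catalanReal_succ (k : ℕ) :
    catalanReal (k + 1) = catalanReal k * (2 * (2 * k + 1)) / (k + 2) := by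
  have h1 : ((k.factorial : ℕ) : ℝ) ≠ 0 := by positivity
  unfold catalanReal
  rw [show 2 * (k + 1) = 2 * k + 1 + 1 by ring]
  simp only [Nat.factorial_succ]
  push_cast
  field_simp
  ring

lemma hasDerivAt_staysBelowLimit (k : ℕ) (x : ℝ) :
    HasDerivAt (staysBelowLimit k)
      ((2 * k + 1) * catalanReal k / 2 * ((k + 1) * ((1 - x ^ 2) / 4) ^ k
        + k * (((1 - x) / 2) ^ (k + 1) * ((1 + x) / 2) ^ (k - 1)))) x := by
  have hI (p q : ℕ) (z : ℝ) :
      HasDerivAt (fun z => ∫ s in (0 : ℝ)..z, s ^ p * (1 - s) ^ q) (z ^ p * (1 - z) ^ q) z := by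
    have hc : Continuous fun s : ℝ => s ^ p * (1 - s) ^ q := by fun_prop
    exact intervalIntegral.integral_hasDerivAt_right (hc.intervalIntegrable _ _)
      (hc.stronglyMeasurableAtFilter _ _) hc.continuousAt
  have h1 : HasDerivAt (fun x : ℝ => (1 + x) / 2) (1 / 2) x :=
    ((hasDerivAt_id x).const_add 1).div_const 2
  have h2 : HasDerivAt (fun x : ℝ => (1 - x) / 2) (-1 / 2) x :=
    ((hasDerivAt_id x).const_sub 1).div_const 2
  have h3 := ((hI k k ((1 + x) / 2)).comp x h1).div_const (k.factorial * k.factorial : ℝ)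
  rcases k with _ | k
  · have h4 := h3.const_mul ((1 : ℕ).factorial : ℝ)
    unfold staysBelowLimit
    simp only [Function.comp_def] at h4
    convert! h4 using 1
    · simp
    · simp [catalanReal]
  · have h4 := ((hI (k + 2) k ((1 - x) / 2)).comp x h2).div_const
      ((k + 2).factorial * k.factorial : ℝ)
    have h5 := (h3.sub h4).const_mul ((2 * (k + 1) + 1).factorial : ℝ)
    unfold staysBelowLimit
    simp only [Function.comp_def] at h5
    convert! h5 using 1
    rw [show (1 - x ^ 2) / 4 = (1 + x) / 2 * ((1 - x) / 2) by ring,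
      show 1 - (1 + x) / 2 = (1 - x) / 2 by ring, show 1 - (1 - x) / 2 = (1 + x) / 2 by ring]
    have h1 : ((k.factorial : ℕ) : ℝ) ≠ 0 := by positivity
    have h2 : (((2 * (k + 1)).factorial : ℕ) : ℝ) ≠ 0 := by positivity
    unfold catalanReal
    rw [Nat.factorial_succ (2 * (k + 1))]
    simp only [Nat.factorial_succ k, Nat.factorial_succ (k + 1), Nat.add_sub_cancel, mul_pow]
    push_cast
    generalize (1 + x) / 2 = a
    generalize (1 - x) / 2 = b
    field_simp
    ring

/-- The target derivative is that of `staysBelowLimit k`. Induction on `k` applies because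
consecutive functions differ by one summand and the change of the last term, with `catalanReal_succ`
linking the coefficients. -/
lemma hasDerivAt_sum_catalanReal (k : ℕ) (x : ℝ) :
    HasDerivAt (fun x : ℝ => x * ∑ j ∈ Finset.range k, ((1 - x ^ 2) / 4) ^ j
        * ((j + 1) * catalanReal j) + catalanReal k * (((1 - x ^ 2) / 4) ^ k / 2 * (x + (2 * k + 1))))
      ((2 * k + 1) * catalanReal k / 2 * ((k + 1) * ((1 - x ^ 2) / 4) ^ k
        + k * (((1 - x) / 2) ^ (k + 1) * ((1 + x) / 2) ^ (k - 1)))) x := by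
  have hy : HasDerivAt (fun x : ℝ => (1 - x ^ 2) / 4) (-x / 2) x := by
    have := ((hasDerivAt_pow 2 x).const_sub 1).div_const 4
    convert! this using 1
    norm_num
    ring
  have hx (c : ℝ) : HasDerivAt (fun x : ℝ => x + c) 1 x := (hasDerivAt_id x).add_const c
  induction k with
  | zero =>
    have := ((hx 1).const_mul (1 / 2 : ℝ))
    convert! this using 1
    · ext y; simp [catalanReal]
    · simp [catalanReal]
  | succ k ih =>
    have h1 := (((hasDerivAt_id x).mul (hy.pow k)).mul_const ((k + 1) * catalanReal k))
    have h2 := (((hy.pow (k + 1)).div_const 2).mul (hx (2 * (k + 1 : ℕ) + 1))).const_mul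
      (catalanReal (k + 1))
    have h3 := (((hy.pow k).div_const 2).mul (hx (2 * k + 1))).const_mul (catalanReal k)
    have h4 := ((ih.add h1).add h2).sub h3
    convert! h4 using 1
    · ext z
      simp only [Finset.sum_range_succ, Pi.add_apply, Pi.sub_apply, Pi.mul_apply, Pi.pow_apply, id]
      push_cast
      ring
    · rw [catalanReal_succ]
      simp only [Pi.pow_apply, id, Nat.add_sub_cancel]
      -- In terms of `a = (1 - x) / 2` every factor is a power of `a` or `1 - a`, and the identity
      -- becomes polynomial.
      obtain ⟨a, rfl⟩ : ∃ a, x = 1 - 2 * a := ⟨(1 - x) / 2, by ring⟩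
      rw [show (1 - (1 - 2 * a) ^ 2) / 4 = a * (1 - a) by ring,
        show (1 - (1 - 2 * a)) / 2 = a by ring, show (1 + (1 - 2 * a)) / 2 = 1 - a by ring]
      rcases k with _ | k
      · simp [catalanReal]; ring
      · simp only [mul_pow, Nat.add_sub_cancel]
        push_cast
        field_simp
        ring

theorem staysBelowLimit_eq (k : ℕ) (x : ℝ) :
    staysBelowLimit k x = x * ∑ j ∈ Finset.range k, ((1 - x ^ 2) / 4) ^ j
        * ((j + 1) * catalanReal j)
      + catalanReal k * (((1 - x ^ 2) / 4) ^ k / 2 * (x + (2 * k + 1))) := by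
  have h (x : ℝ) := (hasDerivAt_staysBelowLimit k x).sub (hasDerivAt_sum_catalanReal k x)
  have h1 := is_const_of_deriv_eq_zero (fun x => (h x).differentiableAt)
    (fun x => by rw [(h x).deriv, sub_self]) x 1
  have h2 : staysBelowLimit k 1 = 1 := by
    unfold staysBelowLimit
    rw [show ((1 : ℝ) + 1) / 2 = 1 by norm_num, sub_self, zero_div,
      intervalIntegral.integral_same, integral_pow_mul_one_sub_pow, ← two_mul]
    simp
    field_simp
  have h3 : (1 : ℝ) * ∑ j ∈ Finset.range k, ((1 - (1 : ℝ) ^ 2) / 4) ^ j * ((j + 1) * catalanReal j)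
      + catalanReal k * (((1 - (1 : ℝ) ^ 2) / 4) ^ k / 2 * (1 + (2 * k + 1))) = 1 := by
    rcases k with _ | k
    · simp [catalanReal]; norm_num
    · rw [Finset.sum_range_succ']
      simp [catalanReal]
  simp only [Pi.sub_apply] at h1
  rw [h2, h3, sub_self] at h1
  exact sub_eq_zero.1 h1

/-! ### Walks with a free endpoint. -/

/-- The sets of `n` marked cells among the first `m` cells whose walk stays at or below `b`. -/
def boundedPaths (b n m : ℕ) : Finset (Finset ℕ) :=
  ((Finset.range m).powersetCard n).filter fun J => ∀ i ≤ m, 2 * upSteps J i ≤ i + b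

lemma card_boundedPaths (b n m : ℕ) :
    (boundedPaths b n m).card = ∑ u ∈ Finset.range (m + 1), (markedPaths b n m u).card := by
  rw [Finset.card_eq_sum_card_fiberwise (f := fun J => upSteps J m) (t := Finset.range (m + 1))]
  · refine Finset.sum_congr rfl fun u _ => ?_
    unfold boundedPaths markedPaths
    rw [Finset.filter_filter]
    simp only [and_comm]
  · intro J _
    simpa using Nat.lt_succ_of_le (upSteps_le J m)

/-- Sums the reflection formula over `u + 1` up-steps and `m - 1 - u` down-steps; the endpoint is at
or below level `b + 1` exactly when `u < (m + b + 1) / 2`. -/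
lemma card_boundedPaths_odd {b m : ℕ} (k : ℕ) (hb : b + 1 ≤ m) :
    (boundedPaths (b + 1) (2 * k + 1) m).card + (if k = 0 then 0 else
        ∑ w ∈ Finset.range ((m + b + 1) / 2 - b), w.choose (k + 1) * (m - 1 - w).choose (k - 1))
      = ∑ u ∈ Finset.range ((m + b + 1) / 2), u.choose k * (m - 1 - u).choose k := by
  have hsub : Finset.range ((m + b + 1) / 2) ⊆ Finset.range m := by
    intro u hu
    rw [Finset.mem_range] at hu ⊢
    omega
  rw [card_boundedPaths, Finset.sum_range_succ', card_markedPaths_odd_zero, add_zero,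
    ← Finset.sum_subset hsub]
  · have h1 : (if k = 0 then 0 else
        ∑ w ∈ Finset.range ((m + b + 1) / 2 - b), w.choose (k + 1) * (m - 1 - w).choose (k - 1))
        = ∑ u ∈ Finset.range ((m + b + 1) / 2), if k = 0 then 0 else
          (u - b).choose (k + 1) * (m - 1 - u + b).choose (k - 1) := by
      split_ifs with hk
      · simp
      -- Terms with `u < b` vanish because `u - b` truncates to `0`; the rest are reindexed by `w =
      -- u - b`.
      · have h2 : (m + b + 1) / 2 = b + ((m + b + 1) / 2 - b) := by omega
        conv_rhs => rw [h2, Finset.sum_range_add]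
        rw [Finset.sum_eq_zero (s := Finset.range b), zero_add]
        · refine Finset.sum_congr rfl fun w hw => ?_
          rw [Finset.mem_range] at hw
          congr 2 <;> omega
        · intro u hu
          rw [Finset.mem_range] at hu
          rw [Nat.sub_eq_zero_of_le hu.le]
          simp
    rw [h1, ← Finset.sum_add_distrib]
    refine Finset.sum_congr rfl fun u hu => ?_
    rw [Finset.mem_range] at hu
    rw [(card_markedPaths_reflection b m).1 k u (m - 1 - u) (by omega) (by omega), mul_comm]
  · intro u _ hu
    rw [Finset.mem_range] at hu
    rw [markedPaths_eq_empty_of_lt (by omega), Finset.card_empty]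

open Filter Topology in
theorem tendsto_card_boundedPaths {b : ℕ → ℕ} {x : ℝ} (hx : x < 1)
    (hb : Tendsto (fun m => (b m : ℝ) / m) atTop (𝓝 x)) (k : ℕ) :
    Tendsto (fun m => ((boundedPaths (b m + 1) (2 * k + 1) m).card : ℝ)
      * ((2 * k + 1).factorial / m ^ (2 * k + 1))) atTop (𝓝 (staysBelowLimit k x)) := by
  have hx0 : 0 ≤ x := ge_of_tendsto' hb fun m => by positivity
  have hbm : ∀ᶠ m in atTop, b m + 1 ≤ m := by
    filter_upwards [hb.eventually_lt_const hx, eventually_gt_atTop 0] with m h hm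
    have hm' : (0 : ℝ) < m := by positivity
    rw [div_lt_one hm'] at h
    exact_mod_cast h
  have hinv : Tendsto (fun m : ℕ => 1 / (m : ℝ)) atTop (𝓝 0) :=
    tendsto_const_div_atTop_nhds_zero_nat 1
  have hbd (m : ℕ) : (m : ℝ) + b m ≤ 2 * ((m + b m + 1) / 2 : ℕ) ∧
      2 * (((m + b m + 1) / 2 : ℕ) : ℝ) ≤ m + b m + 1 := by
    constructor
    · exact_mod_cast (by omega : m + b m ≤ 2 * ((m + b m + 1) / 2))
    · exact_mod_cast (by omega : 2 * ((m + b m + 1) / 2) ≤ m + b m + 1)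
  have ha : Tendsto (fun m => (((m + b m + 1) / 2 : ℕ) : ℝ) / m) atTop (𝓝 ((1 + x) / 2)) := by
    have h1 : Tendsto (fun m : ℕ => (1 + (b m : ℝ) / m) / 2) atTop (𝓝 ((1 + x) / 2)) :=
      (hb.const_add 1).div_const 2
    have h2 : Tendsto (fun m : ℕ => (1 + (b m : ℝ) / m + 1 / (m : ℝ)) / 2) atTop
        (𝓝 ((1 + x + 0) / 2)) := ((hb.const_add 1).add hinv).div_const 2
    rw [add_zero] at h2
    refine tendsto_of_tendsto_of_tendsto_of_le_of_le' h1 h2 ?_ ?_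
    · filter_upwards [eventually_gt_atTop 0] with m hm
      have hm' : (0 : ℝ) < m := by positivity
      have := (hbd m).1
      field_simp
      linarith
    · filter_upwards [eventually_gt_atTop 0] with m hm
      have hm' : (0 : ℝ) < m := by positivity
      have := (hbd m).2
      field_simp
      linarith
  have ha' : Tendsto (fun m => (((m + b m + 1) / 2 - b m : ℕ) : ℝ) / m) atTop
      (𝓝 ((1 - x) / 2)) := by
    have h1 := ha.sub hb
    rw [show (1 + x) / 2 - x = (1 - x) / 2 by ring] at h1
    refine h1.congr' ?_
    filter_upwards [hbm] with m hm
    rw [Nat.cast_sub (by omega), sub_div]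
  have h1 := tendsto_sum_choose_mul_choose (by linarith)
    (hbm.mono fun m hm => by omega) ha k k
  unfold staysBelowLimit
  rcases k with _ | k
  · refine (h1.const_mul ((2 * 0 + 1).factorial : ℝ)).congr' ?_ |>.trans ?_
    · filter_upwards [hbm] with m hm
      have := card_boundedPaths_odd 0 hm
      simp only [if_true, add_zero] at this
      rw [this]
      push_cast
      simp
      field_simp
    · simp
  · have h2 := tendsto_sum_choose_mul_choose (by linarith)
      (hbm.mono fun m hm => by omega) ha' (k + 2) k
    rw [if_neg (Nat.succ_ne_zero k)]
    refine ((h1.sub h2).const_mul ((2 * (k + 1) + 1).factorial : ℝ)).congr' ?_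
    filter_upwards [hbm] with m hm
    have := card_boundedPaths_odd (k + 1) hm
    rw [if_neg (Nat.succ_ne_zero k), ← Nat.cast_inj (R := ℝ), Nat.cast_add, ← eq_sub_iff_add_eq]
      at this
    rw [this, show k + 1 + (k + 1) + 1 = 2 * (k + 1) + 1 by ring,
      show k + 2 + k + 1 = 2 * (k + 1) + 1 by ring, ← sub_div]
    push_cast
    ring

/-! ### Comparing telegraph paths with lattice walks. -/

/-- The `i`-th point of the grid dividing `[0, t]` into `m` cells. -/
noncomputable def gridPoint (t : ℝ≥0) (m i : ℕ) : ℝ≥0 := t * i / m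

lemma gridPoint_coe (t : ℝ≥0) (m i : ℕ) : ((gridPoint t m i : ℝ≥0) : ℝ) = t * i / m := by
  simp [gridPoint]

lemma gridPoint_monotone (t : ℝ≥0) (m : ℕ) : Monotone (gridPoint t m) := by
  intro i j h
  unfold gridPoint
  gcongr

lemma gridPoint_zero (t : ℝ≥0) (m : ℕ) : gridPoint t m 0 = 0 := by simp [gridPoint]

lemma gridPoint_self (t : ℝ≥0) {m : ℕ} (hm : 0 < m) : gridPoint t m m = t := by
  have : (m : ℝ≥0) ≠ 0 := by positivity
  simp [gridPoint, this]

lemma markCount_succ (J : Finset ℕ) (i : ℕ) :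
    markCount J (i + 1) = markCount J i + if i ∈ J then 1 else 0 := by
  unfold markCount
  have h : J.filter (· < i + 1) = J.filter (· < i) ∪ J.filter (· = i) := by
    ext j; simp only [Finset.mem_filter, Finset.mem_union]; grind
  rw [h, Finset.card_union_of_disjoint]
  · congr 1
    rw [Finset.filter_eq']
    split_ifs <;> simp
  · rw [Finset.disjoint_left]
    intro j h1 h2
    simp only [Finset.mem_filter] at h1 h2
    omega

lemma markCount_zero (J : Finset ℕ) : markCount J 0 = 0 := by simp [markCount]

lemma markCount_le_card (J : Finset ℕ) (i : ℕ) : markCount J i ≤ J.card :=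
  Finset.card_filter_le _ _

section Path

variable {Ω : Type*} {V : Ω → ℝ} {N : ℝ≥0 → Ω → ℕ} {ω : Ω} {c : ℝ}

lemma intervalIntegrable_telegraph (h : Monotone fun s => N s ω) (a b : ℝ) :
    IntervalIntegrable (fun s : ℝ => V ω * (-1 : ℝ) ^ N s.toNNReal ω) volume a b := by
  have hm : Measurable fun s : ℝ => V ω * (-1 : ℝ) ^ N s.toNNReal ω := by
    have h1 : Measurable fun s : ℝ => N s.toNNReal ω :=
      (h.comp fun a b hab => Real.toNNReal_mono hab).measurable
    exact measurable_const.mul ((measurable_from_top (f := fun n : ℕ => (-1 : ℝ) ^ n)).comp h1)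
  refine (intervalIntegrable_const (c := |V ω|)).mono_fun hm.aestronglyMeasurable ?_
  exact Filter.Eventually.of_forall fun s => by simp

lemma telegraph_sub (h : Monotone fun s => N s ω) (a b : ℝ≥0) :
    telegraph V N b ω - telegraph V N a ω
      = ∫ s in (a : ℝ)..b, V ω * (-1 : ℝ) ^ N s.toNNReal ω :=
  intervalIntegral.integral_interval_sub_left (intervalIntegrable_telegraph h _ _)
    (intervalIntegrable_telegraph h _ _)

lemma abs_telegraph_sub_le (hc : 0 < c) (h : Monotone fun s => N s ω) (hV : V ω = -c)
    (a b : ℝ≥0) :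
    |telegraph V N b ω - telegraph V N a ω| ≤ c * |(b : ℝ) - a| := by
  rw [telegraph_sub h, ← Real.norm_eq_abs]
  refine intervalIntegral.norm_integral_le_of_norm_le_const fun s _ => ?_
  simp [hV, abs_of_pos hc]

lemma count_eq_markCount {J : Finset ℕ} {t : ℝ≥0} {m : ℕ} (h : Monotone fun s => N s ω)
    (h0 : N 0 ω = 0) (hJ : ∀ i < m, N (gridPoint t m (i + 1)) ω - N (gridPoint t m i) ω
      = if i ∈ J then 1 else 0) {i : ℕ} (hi : i ≤ m) :
    N (gridPoint t m i) ω = markCount J i := by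
  induction i with
  | zero => rw [gridPoint_zero, h0, markCount_zero]
  | succ i ih =>
    rw [markCount_succ, ← ih (by omega), ← hJ i (by omega)]
    have := h (gridPoint_monotone t m (Nat.le_add_right i 1))
    simp only at this
    omega

/-- Over an unmarked cell the velocity is constant and the path moves exactly like the walk. Over a
marked cell both move by at most `c * (t / m)`, so the error grows by at most twice that. -/
lemma abs_telegraph_sub_upSteps_le (hc : 0 < c) {J : Finset ℕ} {t : ℝ≥0} {m : ℕ}
    (h : Monotone fun s => N s ω) (h0 : N 0 ω = 0) (hV : V ω = -c)
    (hJ : ∀ i < m, N (gridPoint t m (i + 1)) ω - N (gridPoint t m i) ω = if i ∈ J then 1 else 0)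
    {i : ℕ} (hi : i ≤ m) :
    |telegraph V N (gridPoint t m i) ω - c * (t / m) * (2 * upSteps J i - i)|
      ≤ 2 * (c * (t / m)) * markCount J i := by
  induction i with
  | zero => simp [gridPoint_zero, upSteps_zero, markCount_zero, telegraph]
  | succ i ih =>
    have ih := ih (by omega)
    have hδ : ((gridPoint t m (i + 1) : ℝ≥0) : ℝ) - gridPoint t m i = t / m := by
      rw [gridPoint_coe, gridPoint_coe]; push_cast; ring
    have hδ0 : 0 ≤ c * ((t : ℝ) / m) := by positivity
    have hstep : |telegraph V N (gridPoint t m (i + 1)) ω - telegraph V N (gridPoint t m i) ω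
        - c * (t / m) * (2 * (if Odd (markCount J (i + 1)) then 1 else 0) - 1)|
        ≤ 2 * (c * (t / m)) * (if i ∈ J then 1 else 0) := by
      split_ifs with ho hi' hi'
      · have h1 := abs_telegraph_sub_le hc h hV (gridPoint t m i) (gridPoint t m (i + 1))
        rw [hδ, abs_of_nonneg (show 0 ≤ (t : ℝ) / m by positivity)] at h1
        rw [abs_le] at h1 ⊢
        constructor <;> linarith
      rotate_left
      · have h1 := abs_telegraph_sub_le hc h hV (gridPoint t m i) (gridPoint t m (i + 1))
        rw [hδ, abs_of_nonneg (show 0 ≤ (t : ℝ) / m by positivity)] at h1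
        rw [abs_le] at h1 ⊢
        constructor <;> linarith
      -- The two unmarked cases remain: `N` agrees at both ends of the cell, hence by monotonicity
      -- is constant on it.
      all_goals
        have e1 := count_eq_markCount h h0 hJ (show i ≤ m by omega)
        have e2 := count_eq_markCount h h0 hJ hi
        have e3 : markCount J (i + 1) = markCount J i := by
          rw [markCount_succ, if_neg hi', add_zero]
        have h2 : ∫ s in ((gridPoint t m i : ℝ≥0) : ℝ)..(gridPoint t m (i + 1) : ℝ≥0),
            V ω * (-1 : ℝ) ^ N s.toNNReal ω = ∫ s in ((gridPoint t m i : ℝ≥0) : ℝ)..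
              (gridPoint t m (i + 1) : ℝ≥0), -c * (-1 : ℝ) ^ markCount J (i + 1) := by
          refine intervalIntegral.integral_congr fun s hs => ?_
          rw [uIcc_of_le (NNReal.coe_le_coe.2 (gridPoint_monotone t m (Nat.le_add_right i 1)))] at hs
          have l1 := h (NNReal.le_toNNReal_of_coe_le hs.1)
          have l2 := h (Real.toNNReal_le_iff_le_coe.2 hs.2)
          simp only at l1 l2 ⊢
          rw [hV, show N s.toNNReal ω = markCount J (i + 1) by omega]
        rw [telegraph_sub h, h2, intervalIntegral.integral_const, hδ, smul_eq_mul]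
      · rw [(Nat.not_odd_iff_even.1 ho).neg_one_pow, abs_le]
        constructor <;> linarith
      · rw [ho.neg_one_pow, abs_le]
        constructor <;> linarith
    have hcount : (markCount J (i + 1) : ℝ) = markCount J i + if i ∈ J then 1 else 0 := by
      rw [markCount_succ]; push_cast; rfl
    rw [upSteps_succ, hcount]
    push_cast
    rw [abs_le] at ih hstep ⊢
    constructor <;> linarith

lemma telegraphMax_lt_iff (h : Monotone fun s => N s ω) (t : ℝ≥0) (β : ℝ) :
    telegraphMax V N t ω < β ↔ ∀ s ≤ t, telegraph V N s ω < β := by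
  obtain ⟨⟨s, hs, hs'⟩, hub⟩ := telegraphMax_isGreatest V N t ω h
  refine ⟨fun hlt s hs => (hub ⟨s, ⟨zero_le, hs⟩, rfl⟩).trans_lt hlt, fun H => ?_⟩
  rw [← hs']
  exact H s hs.2

/-- In the margin `b + 2 * n + 1`, `b` bounds the walk, `2 * n` the error at grid points, and `1`
the motion between the grid point preceding `s` and `s` itself. -/
lemma telegraphMax_lt_of_mem_boundedPaths (hc : 0 < c) {J : Finset ℕ} {t : ℝ≥0} {m b n : ℕ}
    (hm : 0 < m) (ht : 0 < t)
    (h : Monotone fun s => N s ω) (h0 : N 0 ω = 0) (hV : V ω = -c)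
    (hJ : ∀ i < m, N (gridPoint t m (i + 1)) ω - N (gridPoint t m i) ω = if i ∈ J then 1 else 0)
    (hJb : J ∈ boundedPaths b n m) {β : ℝ} (hβ : c * (t / m) * (b + 2 * n + 1) < β) :
    telegraphMax V N t ω < β := by
  obtain ⟨hJ1, hJ2⟩ := Finset.mem_filter.1 hJb
  obtain ⟨hJ3, hJ4⟩ := Finset.mem_powersetCard.1 hJ1
  rw [telegraphMax_lt_iff h]
  intro s hs
  have hm' : (0 : ℝ) < m := by positivity
  have ht' : (0 : ℝ) < t := ht
  have hs' : (s : ℝ) ≤ t := hs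
  have hs0 : (0 : ℝ) ≤ s * m / t := by positivity
  set i := ⌊(s : ℝ) * m / t⌋₊ with hi
  have h1 := Nat.floor_le hs0
  have h2 := Nat.lt_floor_add_one ((s : ℝ) * m / t)
  rw [← hi] at h1 h2
  have him : i ≤ m := by
    refine Nat.floor_le_of_le ?_
    rw [div_le_iff₀ ht']
    nlinarith
  rw [le_div_iff₀ ht'] at h1
  rw [div_lt_iff₀ ht'] at h2
  have h3 := abs_telegraph_sub_le hc h hV (gridPoint t m i) s
  have h4 : |(s : ℝ) - gridPoint t m i| ≤ t / m := by
    rw [gridPoint_coe, abs_le]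
    constructor
    · have : (0 : ℝ) ≤ s - t * i / m := by
        rw [sub_nonneg, div_le_iff₀ hm']; linarith
      have : (0 : ℝ) ≤ t / m := by positivity
      linarith
    · rw [sub_le_iff_le_add, ← add_div, le_div_iff₀ hm']; linarith
  have h5 := abs_telegraph_sub_upSteps_le hc h h0 hV hJ him
  have h6 : (markCount J i : ℝ) ≤ n := by rw [← hJ4]; exact_mod_cast markCount_le_card J i
  have h7 : (2 * upSteps J i : ℝ) ≤ i + b := by exact_mod_cast hJ2 i him
  have hδ0 : 0 ≤ c * ((t : ℝ) / m) := by positivity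
  have h8 := mul_le_mul_of_nonneg_left h4 hc.le
  have h9 := mul_le_mul_of_nonneg_left h6 hδ0
  have h10 := mul_le_mul_of_nonneg_left h7 hδ0
  have h11 := (abs_le.1 h3).2
  have h12 := (abs_le.1 h5).2
  linarith

lemma mem_boundedPaths_of_telegraphMax_lt (hc : 0 < c) {J : Finset ℕ} {t : ℝ≥0} {m b n : ℕ}
    (hm : 0 < m) (ht : 0 < t)
    (h : Monotone fun s => N s ω) (h0 : N 0 ω = 0) (hV : V ω = -c)
    (hJ : ∀ i < m, N (gridPoint t m (i + 1)) ω - N (gridPoint t m i) ω = if i ∈ J then 1 else 0)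
    (hJn : J ∈ (Finset.range m).powersetCard n) {β : ℝ} (hβ : β + c * (t / m) * (2 * n)
      ≤ c * (t / m) * b) (hmax : telegraphMax V N t ω < β) :
    J ∈ boundedPaths b n m := by
  obtain ⟨hJ3, hJ4⟩ := Finset.mem_powersetCard.1 hJn
  refine Finset.mem_filter.2 ⟨hJn, fun i hi => ?_⟩
  rw [telegraphMax_lt_iff h] at hmax
  have hle : gridPoint t m i ≤ t := (gridPoint_monotone t m hi).trans (gridPoint_self t hm).le
  have h1 := hmax _ hle
  have h5 := (abs_le.1 (abs_telegraph_sub_upSteps_le hc h h0 hV hJ hi)).1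
  have h6 : (markCount J i : ℝ) ≤ n := by rw [← hJ4]; exact_mod_cast markCount_le_card J i
  have ht' : (0 : ℝ) < t := ht
  have hδ0 : 0 < c * ((t : ℝ) / m) := by positivity
  have h9 := mul_le_mul_of_nonneg_left h6 hδ0.le
  have h10 : c * ((t : ℝ) / m) * (2 * upSteps J i) < c * (t / m) * (i + b) := by linarith
  have h11 := lt_of_mul_lt_mul_left h10 hδ0.le
  exact_mod_cast h11.le

end Path

/-! ### Probabilities of jump patterns. -/

section Cells

variable {Ω : Type*} [MeasurableSpace Ω] {μ : Measure Ω}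
  {V : Ω → ℝ} {N : ℝ≥0 → Ω → ℕ} {c : ℝ} {lam : ℝ≥0}

/-- The event that the initial velocity is `v` and that, among the `m` cells dividing `[0, t]`,
each cell of `J` contains exactly one jump and every other cell none. -/
def cellEvent (V : Ω → ℝ) (N : ℝ≥0 → Ω → ℕ) (v : ℝ) (t : ℝ≥0) (m : ℕ) (J : Finset ℕ) : Set Ω :=
  {ω | V ω = v ∧ ∀ i < m, N (gridPoint t m (i + 1)) ω - N (gridPoint t m i) ω
    = if i ∈ J then 1 else 0}

lemma measurableSet_cellPattern (t : ℝ≥0) (m : ℕ) (J : Finset ℕ) :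
    MeasurableSet {f : ℝ≥0 → ℕ | ∀ i < m, f (gridPoint t m (i + 1)) - f (gridPoint t m i)
      = if i ∈ J then 1 else 0} := by
  rw [ofPred_forall]
  refine MeasurableSet.iInter fun i => ?_
  rw [ofPred_forall]
  have h : Measurable fun f : ℝ≥0 → ℕ =>
      f (gridPoint t m (i + 1)) - f (gridPoint t m i) := by fun_prop
  exact MeasurableSet.iInter fun _ => h (measurableSet_singleton (if i ∈ J then 1 else 0))

lemma measurableSet_cellEvent (hVN : IsTelegraphData V N c lam μ) (v : ℝ) (t : ℝ≥0) (m : ℕ)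
    (J : Finset ℕ) : MeasurableSet (cellEvent V N v t m J) :=
  (measurableSet_eq_fun hVN.measurable_velocity measurable_const).inter
    ((measurable_pi_lambda (fun ω t => N t ω) hVN.poisson.measurable)
      (measurableSet_cellPattern t m J))

lemma measureReal_velocity_inter (hVN : IsTelegraphData V N c lam μ) {A : Set (ℝ≥0 → ℕ)}
    (hA : MeasurableSet A) :
    μ.real {ω | V ω = -c ∧ (fun t => N t ω) ∈ A} = 1 / 2 * μ.real {ω | (fun t => N t ω) ∈ A} := by
  have h := hVN.indep.measure_inter_preimage_eq_mul {-c} A (measurableSet_singleton _) hA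
  have h2 := hVN.prob_neg
  simp only [measureReal_def]
  change μ {ω | V ω = -c ∧ (fun t => N t ω) ∈ A} = μ {ω | V ω = -c}
    * μ {ω | (fun t => N t ω) ∈ A} at h
  rw [h, h2, ENNReal.toReal_mul]
  simp

/-- Increments over the cells are independent, and a Poisson count of `0` or `1` carries no
factorial, so the probability depends on `J` only through its size. This is the uniformity of the
jump pattern. -/
lemma measureReal_cellEvent (hVN : IsTelegraphData V N c lam μ) (t : ℝ≥0) {m : ℕ} (hm : 0 < m)
    {J : Finset ℕ} (hJ : J ⊆ Finset.range m) :
    μ.real (cellEvent V N (-c) t m J)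
      = 1 / 2 * (Real.exp (-(lam * t)) * (lam * t / m : ℝ) ^ J.card) := by
  set A : Set (ℝ≥0 → ℕ) := {f | ∀ i < m, f (gridPoint t m (i + 1)) - f (gridPoint t m i)
    = if i ∈ J then 1 else 0} with hA
  have hAm : MeasurableSet A := measurableSet_cellPattern t m J
  have hm' : (m : ℝ) ≠ 0 := by positivity
  refine (measureReal_velocity_inter hVN hAm).trans ?_
  congr 1
  have hind := hVN.poisson.indepIncrements.nat (gridPoint_monotone t m)
  have h1 := hind.measure_inter_preimage_eq_mul (Finset.range m)
    (sets := fun i => {if i ∈ J then 1 else 0}) (fun i _ => measurableSet_singleton _)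
  have h2 : {ω | (fun t => N t ω) ∈ A} = ⋂ i ∈ Finset.range m,
      (fun ω => N (gridPoint t m (i + 1)) ω - N (gridPoint t m i) ω) ⁻¹'
        {if i ∈ J then 1 else 0} := by
    ext ω; simp [hA]
  have h3 (i : ℕ) : μ.real ((fun ω => N (gridPoint t m (i + 1)) ω - N (gridPoint t m i) ω) ⁻¹'
        {if i ∈ J then 1 else 0}) = Real.exp (-(lam * t / m : ℝ)) *
          if i ∈ J then (lam * t / m : ℝ) else 1 := by
    have hle := gridPoint_monotone t m (Nat.le_add_right i 1)
    have h4 := (hVN.poisson.law_increment _ _ hle).measureReal_eq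
      (p := fun n => n = if i ∈ J then 1 else 0) (MeasurableSet.of_discrete)
    have h5 : ((lam * (gridPoint t m (i + 1) - gridPoint t m i) : ℝ≥0) : ℝ) = lam * t / m := by
      rw [NNReal.coe_mul, NNReal.coe_sub hle, gridPoint_coe, gridPoint_coe]
      push_cast
      ring
    refine h4.trans ?_
    rw [ofPred_eq_eq_singleton, poissonMeasure_real_singleton, h5]
    split_ifs <;> simp
  rw [h2, measureReal_def, h1, ENNReal.toReal_prod]
  simp only [← measureReal_def, h3]
  rw [Finset.prod_mul_distrib, Finset.prod_const, Finset.card_range, ← Real.exp_nat_mul,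
    Finset.prod_ite_mem, Finset.prod_const, Finset.inter_eq_right.2 hJ]
  congr 2
  field_simp

lemma measureReal_biUnion_cellEvent [IsProbabilityMeasure μ] (hVN : IsTelegraphData V N c lam μ) (t : ℝ≥0) {m n : ℕ}
    (hm : 0 < m) {S : Finset (Finset ℕ)} (hS : S ⊆ (Finset.range m).powersetCard n) :
    μ.real (⋃ J ∈ S, cellEvent V N (-c) t m J)
      = S.card * (1 / 2 * (Real.exp (-(lam * t)) * (lam * t / m : ℝ) ^ n)) := by
  rw [measureReal_biUnion_finset _ fun J _ => measurableSet_cellEvent hVN _ _ _ _]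
  · rw [Finset.sum_congr rfl (g := fun _ => 1 / 2 * (Real.exp (-(lam * t))
      * (lam * t / m : ℝ) ^ n)), Finset.sum_const, nsmul_eq_mul]
    intro J hJ
    obtain ⟨h1, h2⟩ := Finset.mem_powersetCard.1 (hS hJ)
    rw [measureReal_cellEvent hVN t hm h1, h2]
  · intro J hJ K hK hne
    rw [Function.onFun, Set.disjoint_left]
    rintro ω ⟨-, h1⟩ ⟨-, h2⟩
    refine hne (Finset.ext fun i => ?_)
    have hJ' := (Finset.mem_powersetCard.1 (hS hJ)).1
    have hK' := (Finset.mem_powersetCard.1 (hS hK)).1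
    rcases Nat.lt_or_ge i m with h | h
    · have h3 := (h1 i h).symm.trans (h2 i h)
      split_ifs at h3 <;> simp_all
    · have h4 : i ∉ J := fun hi => by have := Finset.mem_range.1 (hJ' hi); omega
      have h5 : i ∉ K := fun hi => by have := Finset.mem_range.1 (hK' hi); omega
      simp [h4, h5]

lemma measureReal_velocity_count (hVN : IsTelegraphData V N c lam μ) (t : ℝ≥0) (n : ℕ) :
    μ.real {ω | V ω = -c ∧ N t ω = n}
      = 1 / 2 * (Real.exp (-(lam * t)) * (lam * t : ℝ) ^ n / n.factorial) := by
  refine (measureReal_velocity_inter hVN (A := {f | f t = n})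
    (measurableSet_eq_fun (measurable_pi_apply t) measurable_const)).trans ?_
  congr 1
  have h4 := (hVN.poisson.law_increment 0 t zero_le).measureReal_eq
      (p := fun x => x = n) (MeasurableSet.of_discrete)
  rw [ofPred_eq_eq_singleton, poissonMeasure_real_singleton] at h4
  have h5 : μ.real {ω | (fun t => N t ω) ∈ {f : ℝ≥0 → ℕ | f t = n}}
      = μ.real {ω | N t ω - N 0 ω = n} := by
    refine measureReal_congr ?_
    filter_upwards [hVN.poisson.zero] with ω h0
    refine propext ?_
    change N t ω = n ↔ N t ω - N 0 ω = n
    rw [h0, Nat.sub_zero]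
  rw [h5, h4]
  simp

/-- Comparison of the conditional law of the maximum with the numbers of lattice paths. -/
theorem boundedPaths_bounds [IsProbabilityMeasure μ] (hc : 0 < c) (hlam : 0 < lam)
    (hVN : IsTelegraphData V N c lam μ) {t : ℝ≥0} (ht : 0 < t) {m : ℕ} (hm : 0 < m) (n : ℕ)
    (β : ℝ) :
    (∀ b : ℕ, c * (t / m) * (b + 2 * n + 1) < β →
      (boundedPaths b n m).card * ((n.factorial : ℝ) / m ^ n)
        ≤ (cond μ {ω | V ω = -c ∧ N t ω = n}).real {ω | telegraphMax V N t ω < β}) ∧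
    (∀ b : ℕ, β + c * (t / m) * (2 * n) ≤ c * (t / m) * b →
      (cond μ {ω | V ω = -c ∧ N t ω = n}).real {ω | telegraphMax V N t ω < β}
        ≤ (boundedPaths b n m).card * ((n.factorial : ℝ) / m ^ n)
          + (1 - m.choose n * ((n.factorial : ℝ) / m ^ n))) := by
  set s : Set Ω := {ω | V ω = -c ∧ N t ω = n} with hs
  have hsm : MeasurableSet s :=
    (measurableSet_eq_fun hVN.measurable_velocity measurable_const).inter
      (measurableSet_eq_fun (hVN.poisson.measurable t) measurable_const)
  have hμs := measureReal_velocity_count hVN t n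
  rw [← hs] at hμs
  have ht' : (0 : ℝ) < t := ht
  have hlam' : (0 : ℝ) < lam := hlam
  have hm' : (0 : ℝ) < m := by positivity
  have hpos : 0 < μ.real s := by rw [hμs]; positivity
  -- Relative to `s` each pattern has weight `n! / m ^ n`: the exponential and the powers of `lam *
  -- t` cancel.
  have hG {S : Finset (Finset ℕ)} (hS : S ⊆ (Finset.range m).powersetCard n) :
      μ.real (⋃ J ∈ S, cellEvent V N (-c) t m J)
        = S.card * ((n.factorial : ℝ) / m ^ n) * μ.real s := by
    rw [measureReal_biUnion_cellEvent hVN t hm hS, hμs, div_pow]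
    field_simp
  have hcond (E : Set Ω) : (cond μ s).real E = μ.real (s ∩ E) / μ.real s := by
    rw [measureReal_def, cond_apply hsm, ENNReal.toReal_mul, ENNReal.toReal_inv, inv_mul_eq_div]
    rfl
  rw [hcond]
  have hcount {ω : Ω} {J : Finset ℕ} (hJ : J ∈ (Finset.range m).powersetCard n)
      (hmono : Monotone fun t => N t ω) (h0 : N 0 ω = 0) (hω : ω ∈ cellEvent V N (-c) t m J) :
      ω ∈ s := by
    obtain ⟨h1, h2⟩ := Finset.mem_powersetCard.1 hJ
    refine ⟨hω.1, ?_⟩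
    rw [← h2, ← markCount_of_subset h1 le_rfl, ← count_eq_markCount hmono h0 hω.2 le_rfl,
      gridPoint_self t hm]
  have hsub (b : ℕ) : boundedPaths b n m ⊆ (Finset.range m).powersetCard n :=
    Finset.filter_subset _ _
  constructor
  · intro b hb
    rw [le_div_iff₀ hpos, ← hG (hsub b)]
    refine ENNReal.toReal_mono (measure_ne_top _ _) (measure_mono_ae ?_)
    filter_upwards [hVN.poisson.zero, hVN.poisson.monotone_path] with ω h0 hmono hω
    obtain ⟨J, hJ, hωJ⟩ := mem_iUnion₂.1 hω
    exact ⟨hcount (hsub b hJ) hmono h0 hωJ,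
      telegraphMax_lt_of_mem_boundedPaths hc hm ht hmono h0 hωJ.1 hωJ.2 hJ hb⟩
  · intro b hb
    -- On `G` every cell has at most one jump and the walk comparison applies; `s \ G` is charged in
    -- full and yields the error `1 - m.choose n * (n! / m ^ n)`. Only monotonicity and
    -- subadditivity touch the event of the maximum, so its measurability is not needed.
    set G := ⋃ J ∈ (Finset.range m).powersetCard n, cellEvent V N (-c) t m J with hGdef
    have hGm : MeasurableSet G :=
      Finset.measurableSet_biUnion _ fun J _ => measurableSet_cellEvent hVN _ _ _ _
    have h1 := measureReal_sdiff_add_inter (μ := μ) (s := s) hGm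
    have h2 : μ.real G ≤ μ.real (s ∩ G) := by
      refine ENNReal.toReal_mono (measure_ne_top _ _) (measure_mono_ae ?_)
      filter_upwards [hVN.poisson.zero, hVN.poisson.monotone_path] with ω h0 hmono hω
      obtain ⟨J, hJ, hωJ⟩ := mem_iUnion₂.1 hω
      exact ⟨hcount hJ hmono h0 hωJ, hω⟩
    have h3 : μ.real (s ∩ {ω | telegraphMax V N t ω < β})
        ≤ μ.real ((⋃ J ∈ boundedPaths b n m, cellEvent V N (-c) t m J) ∪ (s \ G)) := by
      refine ENNReal.toReal_mono (measure_ne_top _ _) (measure_mono_ae ?_)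
      filter_upwards [hVN.poisson.zero, hVN.poisson.monotone_path] with ω h0 hmono hω
      by_cases hωG : ω ∈ G
      · obtain ⟨J, hJ, hωJ⟩ := mem_iUnion₂.1 hωG
        exact Or.inl (mem_iUnion₂.2 ⟨J, mem_boundedPaths_of_telegraphMax_lt hc hm ht hmono h0
          hωJ.1 hωJ.2 hJ hb hω.2, hωJ⟩)
      · exact Or.inr ⟨hω.1, hωG⟩
    have h4 := h3.trans (measureReal_union_le _ _)
    rw [hG (hsub b)] at h4
    rw [hG subset_rfl, Finset.card_powersetCard, Finset.card_range] at h2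
    rw [div_le_iff₀ hpos]
    linarith

end Cells

/-! ### Refining the grid. -/

open Filter Topology in
theorem cond_telegraphMax_eq_staysBelowLimit {Ω : Type*} [MeasurableSpace Ω] (μ : Measure Ω)
    [IsProbabilityMeasure μ] (V : Ω → ℝ) (N : ℝ≥0 → Ω → ℕ) (c : ℝ) (lam : ℝ≥0) (hc : 0 < c)
    (hlam : 0 < lam) (hVN : IsTelegraphData V N c lam μ)
    (k : ℕ) (t : ℝ≥0) (β : ℝ) (hβ : 0 < β) (hβt : β < c * t) :
    (cond μ {ω | V ω = -c ∧ N t ω = 2 * k + 1}).real {ω | telegraphMax V N t ω < β}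
      = staysBelowLimit k (β / (c * t)) := by
  have ht' : (0 : ℝ) < t := by
    by_contra h
    nlinarith
  have ht : 0 < t := ht'
  set n := 2 * k + 1 with hn
  set x := β / (c * t) with hx
  have hx0 : 0 < x := by positivity
  have hx1 : x < 1 := by rw [hx, div_lt_one (by positivity)]; exact hβt
  have hβx : β = c * t * x := by rw [hx]; field_simp
  have hfl : Tendsto (fun m : ℕ => (⌊(m : ℝ) * x⌋₊ : ℝ) / m) atTop (𝓝 x) := by
    have := (tendsto_nat_floor_mul_div_atTop hx0.le).comp
      (tendsto_natCast_atTop_atTop (R := ℝ))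
    simpa [Function.comp_def, mul_comm] using this
  have hconst (C : ℝ) : Tendsto (fun m : ℕ => C / (m : ℝ)) atTop (𝓝 0) :=
    tendsto_const_div_atTop_nhds_zero_nat C
  have hlarge : ∀ᶠ m : ℕ in atTop, 2 * n + 4 ≤ ⌊(m : ℝ) * x⌋₊ := by
    have h1 : Tendsto (fun m : ℕ => (m : ℝ) * x) atTop atTop :=
      tendsto_natCast_atTop_atTop.atTop_mul_const hx0
    exact (tendsto_nat_floor_atTop.comp h1).eventually_ge_atTop _
  -- The walk levels are one more than these sequences. Hence the lower one plus its margin `2 * n +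
  -- 1` is `⌊m * x⌋₊ - 1 < m * x`, while the upper one is `⌊m * x⌋₊ + 1 + 2 * n ≥ m * x + 2 * n`.
  have hlow : Tendsto (fun m : ℕ => ((⌊(m : ℝ) * x⌋₊ - (2 * n + 3) : ℕ) : ℝ) / m) atTop (𝓝 x) := by
    have h1 := hfl.sub (hconst (2 * n + 3))
    rw [sub_zero] at h1
    refine h1.congr' ?_
    filter_upwards [hlarge] with m hm
    rw [Nat.cast_sub (by omega), sub_div]
    push_cast
    ring
  have hup : Tendsto (fun m : ℕ => ((⌊(m : ℝ) * x⌋₊ + 2 * n : ℕ) : ℝ) / m) atTop (𝓝 x) := by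
    have h1 := hfl.add (hconst (2 * n))
    rw [add_zero] at h1
    refine h1.congr fun m => ?_
    push_cast
    ring
  have hchoose : Tendsto (fun m : ℕ => (m.choose n : ℝ) * ((n.factorial : ℝ) / m ^ n)) atTop
      (𝓝 1) := by
    have h1 : Tendsto (fun m : ℕ => ((id m : ℕ) : ℝ) / m) atTop (𝓝 1) := by
      refine tendsto_const_nhds.congr' ?_
      filter_upwards [eventually_gt_atTop 0] with m hm
      have hm' : (m : ℝ) ≠ 0 := by positivity
      simp [hm']
    have h2 := (tendsto_choose_div_pow h1 n).mul_const (n.factorial : ℝ)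
    rw [one_pow, div_mul_cancel₀ _ (by positivity)] at h2
    refine h2.congr fun m => ?_
    simp only [id]
    ring
  have hL := tendsto_card_boundedPaths hx1 hlow k
  have hU := (tendsto_card_boundedPaths hx1 hup k).add (hchoose.const_sub 1)
  rw [sub_self, add_zero] at hU
  refine le_antisymm (ge_of_tendsto hU ?_) (le_of_tendsto hL ?_)
  · filter_upwards [eventually_gt_atTop 0] with m hm
    have hm' : (0 : ℝ) < m := by positivity
    refine (boundedPaths_bounds hc hlam hVN ht hm n β).2 _ ?_
    have h1 := (Nat.lt_floor_add_one ((m : ℝ) * x)).le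
    have h2 : β = c * (t / m) * (m * x) := by rw [hβx]; field_simp
    rw [h2, ← mul_add]
    refine mul_le_mul_of_nonneg_left ?_ (by positivity)
    push_cast
    linarith
  · filter_upwards [eventually_gt_atTop 0, hlarge] with m hm hm2
    have hm' : (0 : ℝ) < m := by positivity
    refine (boundedPaths_bounds hc hlam hVN ht hm n β).1 _ ?_
    have h1 := Nat.floor_le (show 0 ≤ (m : ℝ) * x by positivity)
    have h2 : β = c * (t / m) * (m * x) := by rw [hβx]; field_simp
    rw [h2]
    refine mul_lt_mul_of_pos_left ?_ (by positivity)
    rw [Nat.cast_add, Nat.cast_sub (by omega)]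
    push_cast
    linarith

theorem mainTheorem9 {Ω : Type*} [MeasurableSpace Ω] (μ : Measure Ω) [IsProbabilityMeasure μ]
    (V : Ω → ℝ) (N : ℝ≥0 → Ω → ℕ) (c : ℝ) (lam : ℝ≥0) (hc : 0 < c) (hlam : 0 < lam)
    (hVN : IsTelegraphData V N c lam μ)
    (k : ℕ) (t : ℝ≥0) (β : ℝ) (hβ : 0 < β) (hβt : β < c * t) :
    (cond μ {ω | V ω = -c ∧ N t ω = 2 * k + 1}).real {ω | telegraphMax V N t ω < β} =
      β / (c * t) * ∑ j ∈ Finset.range k,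
          ((c ^ 2 * (t : ℝ) ^ 2 - β ^ 2) / (c ^ 2 * (t : ℝ) ^ 2)) ^ j * (1 / 2 ^ (2 * j))
            * (Nat.choose (2 * j) j : ℝ)
        + (Nat.factorial (2 * k) : ℝ) / ((Nat.factorial k : ℝ) * (Nat.factorial (k + 1) : ℝ))
            * ((c ^ 2 * (t : ℝ) ^ 2 - β ^ 2) ^ k / (2 * (2 * c * t) ^ (2 * k)))
            * (β / (c * t) + (2 * k + 1)) := by
  have ht' : (0 : ℝ) < t := by
    by_contra h
    nlinarith
  have hy : (1 - (β / (c * t)) ^ 2) / 4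
      = (c ^ 2 * (t : ℝ) ^ 2 - β ^ 2) / (c ^ 2 * (t : ℝ) ^ 2) * (1 / 2 ^ 2) := by
    field_simp
    norm_num
  rw [cond_telegraphMax_eq_staysBelowLimit μ V N c lam hc hlam hVN k t β hβ hβt,
    staysBelowLimit_eq]
  congr 1
  · congr 1
    refine Finset.sum_congr rfl fun j _ => ?_
    -- Catalan numbers times `j + 1` are the central binomial coefficients of the statement.
    have h1 : ((j : ℝ) + 1) * catalanReal j = Nat.choose (2 * j) j := by
      rw [Nat.cast_choose ℝ (by omega : j ≤ 2 * j), show 2 * j - j = j by omega, catalanReal,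
        Nat.factorial_succ]
      push_cast
      field_simp
    rw [hy, h1, mul_pow, one_div_pow, ← pow_mul]
  · unfold catalanReal
    rw [mul_assoc]
    congr 2
    rw [hy, show (2 * c * (t : ℝ)) ^ (2 * k) = (c ^ 2 * (t : ℝ) ^ 2 * 2 ^ 2) ^ k by
      rw [pow_mul]; ring, ← mul_one_div, div_mul_div_comm, mul_one, div_pow]
    field_simp
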